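/- Theorem (thm:perron-frobenius-for-semigroup). Let $E$ be a complex Banach lattice, i.e. $E=E_{\mathbb R}\oplus iE_{\mathbb R}$ is the complexification of a real Banach lattice $E_{\mathbb R}$ with modulus $|x+iy|=\sup_{\theta\in\mathbb R}(\cos\theta\, x+\sin\theta\, y)$ and norm $\|z\|=\|\,|z|\,\|$. Let $u\in E_+$ be a quasi-interior point, i.e. $E_u=\{z\in E:\ |z|\le cu \text{ for some } c\ge 0\}$ is dense in $E$. For a vector $f \in E$ write $f\gg_u 0$ if $f\in E_{\mathbb R}$ and $f\ge\varepsilon u$ for some $\varepsilon>0$; for a bounded linear operator $S$ on $E$ write $S\gg_u 0$ if $Sf\gg_u 0$ for every $0<f\in E_{\mathbb R}$. Let $(e^{tA})_{t\ge 0}$ be a $C_0$-semigroup on $E$ with generator $A$ which is real, i.e. $e^{tA}E_{\mathbb R}\subseteq E_{\mathbb R}$ for all $t\ge 0$. Assume that the spectral bound $s(A)=\sup\{\operatorname{Re}\lambda:\ \lambda\in\sigma(A)\}$ is not $-\infty$ and is a pole of the resolvent $\lambda\mapsto(\lambda I-A)^{-1}$. Let $P=\frac{1}{2\pi i}\oint(\lambda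 I-A)^{-1}\,d\lambda$ be the spectral projection corresponding to $s(A)$, the integral being taken over a positively oriented circle centred at $s(A)$ such that the closed disk bounded by it contains no other point of $\sigma(A)$. If the semigroup is individually eventually strongly positive with respect to $u$, that is, if for every $0<f\in E_{\mathbb R}$ there is $t_0\ge 0$ such that $e^{tA}f\gg_u 0$ for all $t\ge t_0$, then $P\gg_u 0$. -/

import Mathlib

open Set Filter Topology
open scoped NNReal

/-- `E` is a complex Banach lattice with real part `X`: `X` is a real Banach lattice, `E` is its
complexification `X ⊕ iX`, equipped with the modulus `|x + iy| = sup_θ (cos θ • x + sin θ • y)`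
and with the norm `‖z‖ = ‖|z|‖`. -/
structure ComplexBanachLattice (X E : Type*)
    [NormedAddCommGroup X] [Lattice X] [IsOrderedAddMonoid X] [HasSolidNorm X]
    [NormedSpace ℝ X] [IsOrderedModule ℝ X] [CompleteSpace X]
    [NormedAddCommGroup E] [NormedSpace ℂ E] where
  /-- the embedding of the real part -/
  ofReal : X →ₗ[ℝ] E
  bijective_decomposition :
    Function.Bijective (fun p : X × X => ofReal p.1 + Complex.I • ofReal p.2)
  /-- the modulus -/
  modulus : E → X
  isLUB_modulus : ∀ x y : X,
    IsLUB (range fun θ : ℝ => Real.cos θ • x + Real.sin θ • y)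
      (modulus (ofReal x + Complex.I • ofReal y))
  norm_eq_norm_modulus : ∀ z : E, ‖z‖ = ‖modulus z‖

namespace ComplexBanachLattice

variable {X E : Type*}
  [NormedAddCommGroup X] [Lattice X] [IsOrderedAddMonoid X] [HasSolidNorm X]
  [NormedSpace ℝ X] [IsOrderedModule ℝ X] [CompleteSpace X]
  [NormedAddCommGroup E] [NormedSpace ℂ E]

/-- The principal ideal `E_u = {z : ∃ c ≥ 0, |z| ≤ c u}`. -/
def principalIdeal (L : ComplexBanachLattice X E) (u : X) : Set E :=
  {z | ∃ c : ℝ, 0 ≤ c ∧ L.modulus z ≤ c • u}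

/-- `u` is a quasi-interior point of the positive cone: `u ≥ 0` and `E_u` is dense in `E`. -/
def IsQuasiInterior (L : ComplexBanachLattice X E) (u : X) : Prop :=
  0 ≤ u ∧ Dense (L.principalIdeal u)

/-- `z ≫_u 0`: the vector `z` is real and `z ≥ ε u` for some `ε > 0`. -/
def VecStronglyPos (L : ComplexBanachLattice X E) (u : X) (z : E) : Prop :=
  ∃ x : X, z = L.ofReal x ∧ ∃ ε : ℝ, 0 < ε ∧ ε • u ≤ x

/-- `T ≫_u 0`: `T f ≫_u 0` for every `f > 0`. -/
def OpStronglyPos (L : ComplexBanachLattice X E) (u : X) (T : E →L[ℂ] E) : Prop :=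
  ∀ f : X, 0 < f → L.VecStronglyPos u (T (L.ofReal f))

/-- A bounded operator is real if it leaves the real part invariant. -/
def IsRealOp (L : ComplexBanachLattice X E) (T : E →L[ℂ] E) : Prop :=
  ∀ x : X, ∃ y : X, T (L.ofReal x) = L.ofReal y

end ComplexBanachLattice

/-- A `C₀`-semigroup of bounded operators on `E`. -/
structure C0Semigroup (E : Type*) [NormedAddCommGroup E] [NormedSpace ℂ E] where
  toFun : ℝ≥0 → E →L[ℂ] E
  map_zero : toFun 0 = ContinuousLinearMap.id ℂ E
  map_add : ∀ s t : ℝ≥0, toFun (s + t) = (toFun s).comp (toFun t)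
  continuous_orbit : ∀ z : E, Continuous fun t : ℝ≥0 => toFun t z

namespace C0Semigroup

variable {E : Type*} [NormedAddCommGroup E] [NormedSpace ℂ E]

/-- `y = lim_{t ↓ 0} t⁻¹ (T(t) z - z)`. -/
def HasGenerator (T : C0Semigroup E) (z y : E) : Prop :=
  Tendsto (fun t : ℝ≥0 => ((t : ℝ)⁻¹ : ℝ) • (T.toFun t z - z)) (𝓝[>] 0) (𝓝 y)

theorem HasGenerator.add {T : C0Semigroup E} {z y z' y' : E}
    (h : T.HasGenerator z y) (h' : T.HasGenerator z' y') :
    T.HasGenerator (z + z') (y + y') := by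
  refine (Tendsto.add h h').congr fun t => ?_
  rw [← smul_add, (T.toFun t).map_add]
  congr 1
  abel

theorem HasGenerator.smul {T : C0Semigroup E} {z y : E} (c : ℂ)
    (h : T.HasGenerator z y) : T.HasGenerator (c • z) (c • y) := by
  refine (Tendsto.const_smul h c).congr fun t => ?_
  rw [(T.toFun t).map_smul, ← smul_sub, smul_comm]

theorem HasGenerator.zero (T : C0Semigroup E) : T.HasGenerator 0 0 := by
  simp [HasGenerator]

theorem HasGenerator.unique {T : C0Semigroup E} {z y y' : E}
    (h : T.HasGenerator z y) (h' : T.HasGenerator z y') : y = y' :=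
  tendsto_nhds_unique h h'

/-- The generator `A` of the semigroup: its domain consists of all `z` for which
`A z = lim_{t ↓ 0} t⁻¹ (T(t) z - z)` exists. -/
noncomputable def generator (T : C0Semigroup E) : E →ₗ.[ℂ] E where
  domain :=
    { carrier := {z | ∃ y, T.HasGenerator z y}
      add_mem' := fun ⟨_, h⟩ ⟨_, h'⟩ => ⟨_, h.add h'⟩
      zero_mem' := ⟨0, HasGenerator.zero T⟩
      smul_mem' := fun c _ ⟨_, h⟩ => ⟨_, h.smul c⟩ }
  toFun :=
    { toFun := fun z => z.2.choose
      map_add' := fun z z' =>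
        (z + z').2.choose_spec.unique (z.2.choose_spec.add z'.2.choose_spec)
      map_smul' := fun c z => (c • z).2.choose_spec.unique (z.2.choose_spec.smul c) }

end C0Semigroup

/-- The semigroup is individually eventually strongly positive with respect to `u`: for every
`f > 0` there is `t₀ ≥ 0` with `T(t) f ≫_u 0` for all `t ≥ t₀`. -/
def ComplexBanachLattice.IndivEventuallyStronglyPos {X E : Type*}
    [NormedAddCommGroup X] [Lattice X] [IsOrderedAddMonoid X] [HasSolidNorm X]
    [NormedSpace ℝ X] [IsOrderedModule ℝ X] [CompleteSpace X]
    [NormedAddCommGroup E] [NormedSpace ℂ E]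
    (L : ComplexBanachLattice X E) (u : X) (T : C0Semigroup E) : Prop :=
  ∀ f : X, 0 < f →
    ∃ t₀ : ℝ≥0, ∀ t : ℝ≥0, t₀ ≤ t → L.VecStronglyPos u (T.toFun t (L.ofReal f))

namespace UnboundedOp

variable {E : Type*} [NormedAddCommGroup E] [NormedSpace ℂ E]

/-- `R` is a bounded two-sided inverse of `μ I - A : D(A) → E`. -/
def IsResolventAt (A : E →ₗ.[ℂ] E) (μ : ℂ) (R : E →L[ℂ] E) : Prop :=
  (∀ z : E, ∃ x : A.domain, (x : E) = R z ∧ μ • (x : E) - A x = z) ∧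
    ∀ x : A.domain, R (μ • (x : E) - A x) = x

def resolventSet (A : E →ₗ.[ℂ] E) : Set ℂ := {μ | ∃ R, IsResolventAt A μ R}

def spectrum (A : E →ₗ.[ℂ] E) : Set ℂ := (resolventSet A)ᶜ

open Classical in
/-- The resolvent `(μ I - A)⁻¹`, with value `0` outside the resolvent set. -/
noncomputable def resolvent (A : E →ₗ.[ℂ] E) (μ : ℂ) : E →L[ℂ] E :=
  if h : ∃ R, IsResolventAt A μ R then h.choose else 0

/-- The spectral bound `sup {Re μ : μ ∈ σ(A)} ∈ [-∞, ∞]`. -/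
noncomputable def spectralBound (A : E →ₗ.[ℂ] E) : EReal :=
  sSup ((fun μ : ℂ => ((μ.re : ℝ) : EReal)) '' spectrum A)

/-- `μ₀` is an isolated point of the spectrum at which the resolvent, as an analytic map on the
resolvent set, has a pole. -/
def IsResolventPole (A : E →ₗ.[ℂ] E) (μ₀ : ℂ) : Prop :=
  μ₀ ∈ spectrum A ∧ (∀ᶠ μ in 𝓝[≠] μ₀, μ ∈ resolventSet A) ∧
    MeromorphicAt (resolvent A) μ₀ ∧ meromorphicOrderAt (resolvent A) μ₀ < 0

/-- `P` is the spectral projection of `A` for the isolated spectral value `μ₀`: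
`P = (2πi)⁻¹ ∮ (μ I - A)⁻¹ dμ` over a positively oriented circle about `μ₀` such that `μ₀` is the
only spectral value in the closed disk. -/
def IsSpectralProjection (A : E →ₗ.[ℂ] E) (μ₀ : ℂ) (P : E →L[ℂ] E) : Prop :=
  ∃ r : ℝ, 0 < r ∧ Metric.closedBall μ₀ r ∩ spectrum A = {μ₀} ∧
    P = (2 * (Real.pi : ℂ) * Complex.I)⁻¹ • ∮ μ in C(μ₀, r), resolvent A μ

end UnboundedOp

/-!
Let `s` be the spectral bound of the generator `A`, let `R(μ) = (μ - A)⁻¹`, and let `Q ≠ 0` be the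
leading Laurent coefficient of `R` at the pole `s`, so that `(μ - s)ᵐ R(μ) → Q` as `μ → s`, where
`m ≥ 1` is the order of the pole. The proof shows that `Q ≫_u 0`, deduces that the pole is simple,
and identifies `Q` with the spectral projection `P`.

*Positivity.* Let `K` be the closed cone of all `z` with `T(t) z ≥ 0` for every `t`. For large real
`l`, `R(l)` is the Laplace transform of the semigroup, hence leaves `K` invariant. This propagates
down the real axis to every `l > s` by the Neumann series and a continuity argument
(`UnboundedOp.resolvent_mapsTo_of_le`, `C0Semigroup.resolvent_mapsTo_posOrbitCone`). Therefore
`Q K ⊆ K`. The truncated Laplace transform `R(μ) z - exp (-μ t) T(t) R(μ) z = ∫₀ᵗ exp (-μ r) T(r) z`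
stays bounded as `μ → s`, which gives `T(t) Q = exp (s t) Q` (`C0Semigroup.apply_leadingCoeff`).
Since the orbit of any `f ≥ 0` eventually enters `K`, and `Q f` is a positive multiple of
`Q T(t) f`, the operator `Q` is positive.

*Strong positivity.* As `u` is quasi-interior and `Q ≥ 0` is nonzero, `w = Q u` is nonzero, hence
`w > 0`. It is an eigenvector of the semigroup, so it inherits `w ≫_u 0` from its own orbit. For
`f > 0` some `T(t) f` dominates `ε u`, so `Q f = exp (-s t) Q T(t) f ≥ ε exp (-s t) w ≫_u 0`
(`ComplexBanachLattice.IndivEventuallyStronglyPos.opStronglyPos_leadingCoeff`).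

*Simplicity.* If `m ≥ 2`, the resolvent identity forces `Q² = 0`
(`UnboundedOp.leadingCoeff_mul_self`), whereas strong positivity gives `Q² u > 0`. So `m = 1`, and
Cauchy's integral formula yields `P = Q` (`UnboundedOp.IsSpectralProjection.eq_leadingCoeff`).
-/

/-! ### Resolvents of unbounded operators -/

namespace UnboundedOp

variable {E : Type*} [NormedAddCommGroup E] [NormedSpace ℂ E] {A : E →ₗ.[ℂ] E}

theorem isResolventAt_resolvent {μ : ℂ} (hμ : μ ∈ resolventSet A) :
    IsResolventAt A μ (resolvent A μ) := by
  have h : ∃ R, IsResolventAt A μ R := hμ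
  rw [resolvent, dif_pos h]
  exact h.choose_spec

/-- The resolvent identity `R(μ) - R(ν) = (ν - μ) R(μ) R(ν)`. -/
theorem resolvent_sub_resolvent {μ ν : ℂ} (hμ : μ ∈ resolventSet A) (hν : ν ∈ resolventSet A) :
    resolvent A μ - resolvent A ν = (ν - μ) • (resolvent A μ * resolvent A ν) := by
  ext z
  obtain ⟨x, hx, hz⟩ := (isResolventAt_resolvent hν).1 z
  have h := (isResolventAt_resolvent hμ).2 x
  have e : μ • (x : E) - A x = z - (ν - μ) • (x : E) := by
    rw [← hz, sub_smul]; abel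
  rw [e, map_sub, map_smul] at h
  simp only [sub_apply, smul_apply,
    mul_apply_eq_comp, ← hx]
  rw [sub_eq_iff_eq_add] at h ⊢
  rw [h, add_comm]

theorem resolvent_mul_one_add {μ ν : ℂ} (hμ : μ ∈ resolventSet A) (hν : ν ∈ resolventSet A) :
    resolvent A μ * (1 + (μ - ν) • resolvent A ν) = resolvent A ν := by
  have h := resolvent_sub_resolvent hμ hν
  rw [mul_add, mul_one, mul_smul_comm, ← neg_sub ν μ, neg_smul, ← h]
  abel

variable [CompleteSpace E]

/-- The resolvent is differentiable, since `R(μ) = R(ν) (1 + (μ - ν) R(ν))⁻¹` for `μ` near `ν`. -/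
theorem differentiableOn_resolvent (A : E →ₗ.[ℂ] E) :
    DifferentiableOn ℂ (resolvent A) (resolventSet A) := by
  intro ν hν
  set B : ℂ → E →L[ℂ] E := fun μ => 1 + (μ - ν) • resolvent A ν
  have hB : Differentiable ℂ B := by fun_prop
  have hBν : B ν = 1 := by simp [B]
  have hu : ∀ᶠ μ in 𝓝[resolventSet A] ν, IsUnit (B μ) := by
    refine nhdsWithin_le_nhds (hB.continuous.continuousAt (Units.isOpen.mem_nhds ?_))
    simp [hBν]
  have hd : DifferentiableAt ℂ (fun μ => resolvent A ν * Ring.inverse (B μ)) ν := by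
    refine (differentiableAt_const _).mul ?_
    refine DifferentiableAt.comp (g := Ring.inverse) ν ?_ hB.differentiableAt
    exact differentiableAt_inverse (by simp [hBν])
  refine hd.differentiableWithinAt.congr_of_eventuallyEq ?_ ?_
  · filter_upwards [hu, self_mem_nhdsWithin] with μ h hμ
    rw [← resolvent_mul_one_add hμ hν, mul_assoc, Ring.mul_inverse_cancel _ h, mul_one]
  · simp [hBν]

end UnboundedOp

/-! ### Orbits of a `C₀`-semigroup and its resolvent -/

namespace C0Semigroup

variable {E : Type*} [NormedAddCommGroup E] [NormedSpace ℂ E] (T : C0Semigroup E)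

theorem hasGenerator_generator (x : T.generator.domain) :
    T.HasGenerator (x : E) (T.generator x) :=
  x.2.choose_spec

theorem apply_apply (s t : ℝ≥0) (z : E) : T.toFun s (T.toFun t z) = T.toFun (s + t) z := by
  rw [T.map_add]; rfl

theorem apply_comm (s t : ℝ≥0) (z : E) :
    T.toFun s (T.toFun t z) = T.toFun t (T.toFun s z) := by
  rw [apply_apply, apply_apply, add_comm]

variable {T}

theorem HasGenerator.apply {z y : E} (h : T.HasGenerator z y) (s : ℝ≥0) :
    T.HasGenerator (T.toFun s z) (T.toFun s y) := by
  refine (((T.toFun s).continuous.tendsto y).comp h).congr fun t => ?_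
  rw [Function.comp_apply, ContinuousLinearMap.map_smul_of_tower, map_sub, T.apply_comm s t]

/-- The semigroup commutes with the resolvent of its generator. -/
theorem resolvent_apply_comm {μ : ℂ} (hμ : μ ∈ UnboundedOp.resolventSet T.generator)
    (t : ℝ≥0) (z : E) :
    UnboundedOp.resolvent T.generator μ (T.toFun t z) =
      T.toFun t (UnboundedOp.resolvent T.generator μ z) := by
  have hR := UnboundedOp.isResolventAt_resolvent hμ
  obtain ⟨x, hx, hz⟩ := hR.1 z
  have hg := (T.hasGenerator_generator x).apply t
  let x' : T.generator.domain := ⟨T.toFun t x, _, hg⟩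
  have hx' : T.generator x' = T.toFun t (T.generator x) :=
    (T.hasGenerator_generator x').unique hg
  have h := hR.2 x'
  rw [hx'] at h
  rw [← hx, ← hz, map_sub, map_smul]
  exact h

/-- On the domain of the generator, orbits are differentiable from the right. -/
theorem HasGenerator.hasDerivWithinAt {z y : E} (h : T.HasGenerator z y) {r : ℝ} (hr : 0 ≤ r) :
    HasDerivWithinAt (fun r : ℝ => T.toFun r.toNNReal z) (T.toFun r.toNNReal y) (Ioi r) r := by
  rw [hasDerivWithinAt_iff_tendsto_slope' (by simp)]
  have hsub : Tendsto (fun q : ℝ => (q - r).toNNReal) (𝓝[>] r) (𝓝[>] 0) := by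
    refine tendsto_nhdsWithin_iff.2 ⟨?_, ?_⟩
    · have : Continuous fun q : ℝ => (q - r).toNNReal := by fun_prop
      exact (this.tendsto' r 0 (by simp)).mono_left nhdsWithin_le_nhds
    · filter_upwards [self_mem_nhdsWithin] with q hq
      simpa using hq
  refine (((h.apply r.toNNReal)).comp hsub).congr' ?_
  filter_upwards [self_mem_nhdsWithin] with q hq
  have hq' : 0 ≤ q - r := sub_nonneg.2 (le_of_lt hq)
  rw [slope_def_module, Function.comp_apply, Real.coe_toNNReal _ hq', T.apply_apply,
    ← Real.toNNReal_add hq' hr, sub_add_cancel]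

theorem continuous_exp_smul_orbit (T : C0Semigroup E) (z : E) :
    Continuous fun p : ℂ × ℝ => Complex.exp (-(p.1 * p.2)) • T.toFun p.2.toNNReal z := by
  have := T.continuous_orbit z
  fun_prop

variable [CompleteSpace E]

/-- The truncated Laplace transform
`R(μ) z = exp (-μ t) T(t) R(μ) z + ∫₀ᵗ exp (-μ r) T(r) z dr`. -/
theorem integral_exp_smul_orbit {μ : ℂ} (hμ : μ ∈ UnboundedOp.resolventSet T.generator)
    (t : ℝ≥0) (z : E) :
    ∫ r in (0 : ℝ)..t, Complex.exp (-(μ * r)) • T.toFun r.toNNReal z =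
      UnboundedOp.resolvent T.generator μ z -
        Complex.exp (-(μ * t)) • T.toFun t (UnboundedOp.resolvent T.generator μ z) := by
  obtain ⟨x, hx, hz⟩ := (UnboundedOp.isResolventAt_resolvent hμ).1 z
  rw [← hx]
  have hcont (w : E) :
      Continuous fun r : ℝ => Complex.exp (-(μ * r)) • T.toFun r.toNNReal w :=
    (T.continuous_exp_smul_orbit w).comp (Continuous.prodMk_right μ)
  have key := intervalIntegral.integral_eq_sub_of_hasDeriv_right (a := 0) (b := (t : ℝ))
    (f := fun r : ℝ => -(Complex.exp (-(μ * r)) • T.toFun r.toNNReal (x : E)))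
    (f' := fun r : ℝ => Complex.exp (-(μ * r)) • T.toFun r.toNNReal z)
    (hcont _).neg.continuousOn ?_ ((hcont z).intervalIntegrable _ _)
  · simpa [T.map_zero, neg_add_eq_sub] using key
  · intro r hr
    have hr0 : 0 ≤ r := by
      have := hr.1; rw [min_eq_left t.coe_nonneg] at this; exact this.le
    have he : HasDerivAt (fun r : ℝ => Complex.exp (-(μ * r)))
        (Complex.exp (-(μ * r)) * -(μ * 1)) r :=
      (((hasDerivAt_id (r : ℂ)).const_mul μ).neg.cexp).comp_ofReal
    have := (he.hasDerivWithinAt (s := Ioi r)).smul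
      ((T.hasGenerator_generator x).hasDerivWithinAt hr0)
    refine this.neg.congr_deriv ?_
    rw [← hz, map_sub, map_smul, smul_sub, smul_smul, mul_one, mul_neg, neg_smul]
    abel

/-- For large real `l`, the resolvent is the Laplace transform of the semigroup along the
integers. -/
theorem tendsto_integral_exp_smul_orbit {l : ℝ}
    (hl : (l : ℂ) ∈ UnboundedOp.resolventSet T.generator)
    (hT : Real.log ‖T.toFun 1‖ < l) (z : E) :
    Tendsto (fun n : ℕ =>
      ∫ r in (0 : ℝ)..(n : ℝ≥0), Complex.exp (-((l : ℂ) * r)) • T.toFun r.toNNReal z) atTop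
      (𝓝 (UnboundedOp.resolvent T.generator l z)) := by
  set w := UnboundedOp.resolvent T.generator l z
  simp_rw [integral_exp_smul_orbit hl]
  have hnorm : ∀ n : ℕ, ‖T.toFun n w‖ ≤ ‖T.toFun 1‖ ^ n * ‖w‖ := by
    intro n
    induction n with
    | zero => simp [T.map_zero]
    | succ n ih =>
      rw [Nat.cast_succ, add_comm, ← T.apply_apply, pow_succ', mul_assoc]
      exact (T.toFun 1).le_opNorm_of_le ih
  have hq : Real.exp (-l) * ‖T.toFun 1‖ < 1 := by
    rcases (norm_nonneg (T.toFun 1)).eq_or_lt with h0 | h0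
    · simp [← h0]
    · rw [Real.log_lt_iff_lt_exp h0] at hT
      rw [Real.exp_neg, inv_mul_lt_one₀ (Real.exp_pos _)]
      exact hT
  have hlim : Tendsto (fun n : ℕ => (Real.exp (-l) * ‖T.toFun 1‖) ^ n * ‖w‖) atTop (𝓝 0) := by
    simpa using (tendsto_pow_atTop_nhds_zero_of_lt_one (by positivity) hq).mul_const ‖w‖
  have h0 : Tendsto (fun n : ℕ => Complex.exp (-((l : ℂ) * ((n : ℝ≥0) : ℝ))) • T.toFun n w)
      atTop (𝓝 0) := by
    refine squeeze_zero_norm (fun n => ?_) hlim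
    have he : ‖Complex.exp (-((l : ℂ) * ((n : ℝ≥0) : ℝ)))‖ = Real.exp (-l) ^ n := by
      rw [Complex.norm_exp, ← Real.exp_nat_mul]
      simp [mul_comm]
    rw [norm_smul, he, mul_pow, mul_assoc]
    gcongr
    exact hnorm n
  simpa using tendsto_const_nhds.sub h0

end C0Semigroup

/-! ### The positive cone of a complex Banach lattice -/

namespace ComplexBanachLattice

variable {X E : Type*}
  [NormedAddCommGroup X] [Lattice X] [IsOrderedAddMonoid X] [HasSolidNorm X]
  [NormedSpace ℝ X] [IsOrderedModule ℝ X] [CompleteSpace X]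
  [NormedAddCommGroup E] [NormedSpace ℂ E] (L : ComplexBanachLattice X E)

theorem cos_smul_add_sin_smul_le_modulus (x y : X) (θ : ℝ) :
    Real.cos θ • x + Real.sin θ • y ≤ L.modulus (L.ofReal x + Complex.I • L.ofReal y) :=
  (L.isLUB_modulus x y).1 ⟨θ, rfl⟩

theorem abs_re_le_modulus (x y : X) :
    |x| ≤ L.modulus (L.ofReal x + Complex.I • L.ofReal y) :=
  sup_le (by simpa using L.cos_smul_add_sin_smul_le_modulus x y 0)
    (by simpa using L.cos_smul_add_sin_smul_le_modulus x y Real.pi)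

theorem abs_im_le_modulus (x y : X) :
    |y| ≤ L.modulus (L.ofReal x + Complex.I • L.ofReal y) :=
  sup_le (by simpa using L.cos_smul_add_sin_smul_le_modulus x y (Real.pi / 2))
    (by simpa using L.cos_smul_add_sin_smul_le_modulus x y (-(Real.pi / 2)))

theorem modulus_ofReal (x : X) : L.modulus (L.ofReal x) = |x| := by
  have h := L.isLUB_modulus x 0
  refine le_antisymm (?_ : _ ≤ _) (by simpa using L.abs_re_le_modulus x 0)
  rw [map_zero, smul_zero, add_zero] at h
  refine h.2 ?_
  rintro _ ⟨θ, rfl⟩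
  have hx : 0 ≤ |x| := abs_nonneg x
  have hc : |Real.cos θ| • |x| ≤ |x| := by
    simpa using smul_le_smul_of_nonneg_right (Real.abs_cos_le_one θ) hx
  refine le_trans ?_ hc
  simp only [smul_zero, add_zero]
  rcases le_total 0 (Real.cos θ) with h0 | h0
  · rw [abs_of_nonneg h0]
    exact smul_le_smul_of_nonneg_left (le_abs_self x) h0
  · rw [abs_of_nonpos h0, ← neg_smul_neg]
    exact smul_le_smul_of_nonneg_left (neg_le_abs x) (neg_nonneg.2 h0)

theorem norm_ofReal (x : X) : ‖L.ofReal x‖ = ‖x‖ := by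
  rw [L.norm_eq_norm_modulus, modulus_ofReal, norm_abs_eq_norm]

/-- The positive cone `E₊` of the complex Banach lattice, consisting of the real vectors
`x ≥ 0`. -/
noncomputable def posCone : PointedCone ℝ E :=
  (PointedCone.positive ℝ X).map L.ofReal

variable {L}

theorem mem_posCone {z : E} : z ∈ L.posCone ↔ ∃ x : X, 0 ≤ x ∧ L.ofReal x = z := by
  simp [posCone, PointedCone.mem_map]

theorem isometry_ofReal (L : ComplexBanachLattice X E) : Isometry L.ofReal :=
  AddMonoidHomClass.isometry_of_norm _ L.norm_ofReal

theorem ofReal_mem_posCone {x : X} : L.ofReal x ∈ L.posCone ↔ 0 ≤ x := by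
  refine ⟨fun h => ?_, fun h => mem_posCone.2 ⟨x, h, rfl⟩⟩
  obtain ⟨y, hy, e⟩ := mem_posCone.1 h
  rwa [← L.isometry_ofReal.injective e]

theorem isClosed_posCone (L : ComplexBanachLattice X E) : IsClosed (L.posCone : Set E) := by
  rw [posCone, PointedCone.coe_map]
  refine L.isometry_ofReal.isClosedEmbedding.isClosedMap _ ?_
  have : ((PointedCone.positive ℝ X : PointedCone ℝ X) : Set X) = Ici 0 := by ext; simp
  rw [this]
  exact isClosed_Ici

theorem eq_zero_of_mem_posCone_of_neg_mem {z : E} (h : z ∈ L.posCone) (h' : -z ∈ L.posCone) :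
    z = 0 := by
  obtain ⟨x, hx, rfl⟩ := mem_posCone.1 h
  rw [← map_neg, ofReal_mem_posCone, neg_nonneg] at h'
  rw [le_antisymm h' hx, map_zero]

theorem VecStronglyPos.mem_posCone {u : X} (hu : 0 ≤ u) {z : E} (h : L.VecStronglyPos u z) :
    z ∈ L.posCone := by
  obtain ⟨x, rfl, ε, hε, hx⟩ := h
  exact ofReal_mem_posCone.2 ((smul_nonneg hε.le hu).trans hx)

theorem vecStronglyPos_iff {u : X} {z : E} :
    L.VecStronglyPos u z ↔ ∃ ε : ℝ, 0 < ε ∧ z - ε • L.ofReal u ∈ L.posCone := by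
  constructor
  · rintro ⟨x, rfl, ε, hε, hx⟩
    refine ⟨ε, hε, ?_⟩
    rwa [← map_smul, ← map_sub, ofReal_mem_posCone, sub_nonneg]
  · rintro ⟨ε, hε, h⟩
    obtain ⟨x, hx, e⟩ := ComplexBanachLattice.mem_posCone.1 h
    refine ⟨x + ε • u, ?_, ε, hε, by simpa using hx⟩
    rw [map_add, map_smul, e, sub_add_cancel]

theorem VecStronglyPos.smul {u : X} {z : E} (h : L.VecStronglyPos u z) {c : ℝ} (hc : 0 < c) :
    L.VecStronglyPos u (c • z) := by
  obtain ⟨ε, hε, h⟩ := vecStronglyPos_iff.1 h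
  refine vecStronglyPos_iff.2 ⟨c * ε, mul_pos hc hε, ?_⟩
  rw [mul_smul, ← smul_sub]
  exact PointedCone.smul_mem _ hc.le h

theorem VecStronglyPos.add_mem_posCone {u : X} {z w : E} (h : L.VecStronglyPos u z)
    (hw : w ∈ L.posCone) : L.VecStronglyPos u (w + z) := by
  obtain ⟨ε, hε, h⟩ := vecStronglyPos_iff.1 h
  refine vecStronglyPos_iff.2 ⟨ε, hε, ?_⟩
  rw [add_sub_assoc]
  exact add_mem hw h

/-- A positive operator vanishing at a quasi-interior point is zero, since it vanishes on the
principal ideal. -/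
theorem IsQuasiInterior.eq_zero_of_apply_eq_zero {u : X} (hu : L.IsQuasiInterior u)
    {Q : E →L[ℂ] E} (hQ : ∀ z ∈ L.posCone, Q z ∈ L.posCone) (h0 : Q (L.ofReal u) = 0) :
    Q = 0 := by
  have hreal : ∀ (x : X) (c : ℝ), |x| ≤ c • u → Q (L.ofReal x) = 0 := by
    intro x c hx
    have h1 := hQ _ (ofReal_mem_posCone.2 (sub_nonneg.2 ((le_abs_self x).trans hx)))
    have h2 := hQ _ (ofReal_mem_posCone.2 (sub_nonneg.2 ((neg_le_abs x).trans hx)))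
    simp only [map_sub, map_neg, map_smul, ContinuousLinearMap.map_smul_of_tower, h0, smul_zero,
      zero_sub, neg_neg] at h1 h2
    exact eq_zero_of_mem_posCone_of_neg_mem h2 h1
  have hcl : IsClosed {z : E | Q z = 0} := isClosed_eq Q.continuous continuous_const
  ext z
  refine hcl.closure_subset_iff.2 ?_ (hu.2 z)
  rintro w ⟨c, -, hw⟩
  obtain ⟨⟨x, y⟩, rfl⟩ := L.bijective_decomposition.2 w
  simp only [mem_ofPred_eq, map_add, map_smul] at hw ⊢
  rw [hreal x c ((L.abs_re_le_modulus x y).trans hw),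
    hreal y c ((L.abs_im_le_modulus x y).trans hw), smul_zero, add_zero]

end ComplexBanachLattice

/-! ### Invariant cones of the resolvent -/

section InvariantCone

variable {E : Type*} [NormedAddCommGroup E] [NormedSpace ℂ E]

theorem PointedCone.coe_smul_mem {K : PointedCone ℝ E} {c : ℝ} (hc : 0 ≤ c) {z : E} (hz : z ∈ K) :
    (c : ℂ) • z ∈ K := by
  rw [Complex.coe_smul]
  exact PointedCone.smul_mem K hc hz

variable [CompleteSpace E]

theorem tsum_pow_mapsTo_of_mapsTo {K : PointedCone ℝ E} (hK : IsClosed (K : Set E))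
    {B : E →L[ℂ] E} (hB : MapsTo B K K) (hB1 : ‖B‖ < 1) :
    MapsTo ⇑(∑' n : ℕ, B ^ n) K K := by
  intro z hz
  have hs := (summable_geometric_of_norm_lt_one hB1).hasSum.mapL
    (ContinuousLinearMap.apply ℂ E z)
  refine hK.mem_of_tendsto hs (Eventually.of_forall fun t => sum_mem fun n _ => ?_)
  simp only [ContinuousLinearMap.apply_apply]
  clear * - hB hz
  induction n with
  | zero => simpa using hz
  | succ n ih =>
    rw [pow_succ']
    exact hB ih

/-- Invariance of a closed cone under the resolvent propagates to the left along the real axis: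
by the Neumann series `R(l) = ∑ₙ (l₀ - l)ⁿ R(l₀)ⁿ⁺¹` it passes from `l₀` to all `l < l₀` close to
`l₀`, and by continuity of the resolvent it is preserved under limits. -/
theorem UnboundedOp.resolvent_mapsTo_of_le {A : E →ₗ.[ℂ] E} {K : PointedCone ℝ E}
    (hK : IsClosed (K : Set E)) {a b : ℝ} (hab : a ≤ b)
    (hA : ∀ l : ℝ, a ≤ l → (l : ℂ) ∈ resolventSet A) (hb : MapsTo (resolvent A b) K K) :
    MapsTo (resolvent A a) K K := by
  -- `x` is the distance travelled from `b`, so that the induction runs upwards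
  have hmem : ∀ x ∈ Icc 0 (b - a), ((b - x : ℝ) : ℂ) ∈ resolventSet A := fun x hx =>
    hA _ (by linarith [hx.2])
  have hclosed : IsClosed {S : E →L[ℂ] E | MapsTo S K K} := by
    have : {S : E →L[ℂ] E | MapsTo S K K} = ⋂ z ∈ K, {S : E →L[ℂ] E | S z ∈ (K : Set E)} := by
      ext S; simp [MapsTo]
    rw [this]
    exact isClosed_biInter fun z _ =>
      hK.preimage (ContinuousLinearMap.apply ℂ E z).continuous
  have hcont : ContinuousOn (fun x : ℝ => resolvent A ((b - x : ℝ) : ℂ)) (Icc 0 (b - a)) :=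
    (differentiableOn_resolvent A).continuousOn.comp (by fun_prop) hmem
  have hsub : Icc 0 (b - a) ⊆ {x : ℝ | MapsTo (resolvent A ((b - x : ℝ) : ℂ)) K K} := by
    refine IsClosed.Icc_subset_of_forall_mem_nhdsWithin ?_ (by simpa using hb) ?_
    · rw [inter_comm]
      exact hcont.preimage_isClosed_of_isClosed isClosed_Icc hclosed
    · rintro x ⟨hx, hx'⟩
      have hlim : ∀ᶠ y in 𝓝[>] x, ‖((y - x : ℝ) : ℂ) • resolvent A ((b - x : ℝ) : ℂ)‖ < 1 := by
        refine nhdsWithin_le_nhds (ContinuousAt.eventually_lt (by fun_prop) (by fun_prop) ?_)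
        simp
      filter_upwards [hlim, Ioc_mem_nhdsGT hx'.2] with y hy hyx
      have hyI : y ∈ Icc 0 (b - a) := ⟨hx'.1.trans hyx.1.le, hyx.2⟩
      have h := resolvent_mul_one_add (hmem y hyI) (hmem x (Ico_subset_Icc_self hx'))
      have e : (1 : E →L[ℂ] E) + (((b - y : ℝ) : ℂ) - ((b - x : ℝ) : ℂ)) •
          resolvent A ((b - x : ℝ) : ℂ) =
          1 - ((y - x : ℝ) : ℂ) • resolvent A ((b - x : ℝ) : ℂ) := by
        rw [sub_eq_add_neg (1 : E →L[ℂ] E), ← neg_smul]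
        congr 2
        push_cast
        ring
      rw [e] at h
      have hR : resolvent A ((b - y : ℝ) : ℂ) = resolvent A ((b - x : ℝ) : ℂ) *
          ∑' n : ℕ, (((y - x : ℝ) : ℂ) • resolvent A ((b - x : ℝ) : ℂ)) ^ n := by
        have h' := congrArg
          (· * ∑' n : ℕ, (((y - x : ℝ) : ℂ) • resolvent A ((b - x : ℝ) : ℂ)) ^ n) h
        simpa only [mul_assoc, mul_neg_geom_series _ hy, mul_one] using h'
      have hB : MapsTo (((y - x : ℝ) : ℂ) • resolvent A ((b - x : ℝ) : ℂ)) K K := fun z hz =>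
        PointedCone.coe_smul_mem (sub_nonneg.2 hyx.1.le) (hx hz)
      show MapsTo _ _ _
      rw [hR]
      exact fun z hz => hx (tsum_pow_mapsTo_of_mapsTo hK hB hy hz)
  have := hsub (right_mem_Icc.2 (sub_nonneg.2 hab))
  simpa using this

theorem PointedCone.intervalIntegral_mem {K : PointedCone ℝ E} (hK : IsClosed (K : Set E))
    {f : ℝ → E} (hf : Continuous f) {t : ℝ} (ht : 0 ≤ t) (hfK : ∀ r, 0 ≤ r → f r ∈ K) :
    ∫ r in (0 : ℝ)..t, f r ∈ K := by
  rcases ht.eq_or_lt with rfl | ht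
  · simp
  have havg := K.convex.set_average_mem hK (μ := MeasureTheory.volume) (t := uIoc 0 t) (f := f)
    (by simp [uIoc_of_le ht.le, ht]) (by simp [uIoc_of_le ht.le])
    ((MeasureTheory.ae_restrict_iff' measurableSet_uIoc).2 (Eventually.of_forall fun r hr => by
      rw [uIoc_of_le ht.le] at hr
      exact hfK r hr.1.le))
    (intervalIntegrable_iff.1 (hf.intervalIntegrable 0 t))
  rw [interval_average_eq, sub_zero] at havg
  have := PointedCone.smul_mem K ht.le havg
  rwa [smul_inv_smul₀ ht.ne'] at this

end InvariantCone

namespace C0Semigroup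

variable {X E : Type*}
  [NormedAddCommGroup X] [Lattice X] [IsOrderedAddMonoid X] [HasSolidNorm X]
  [NormedSpace ℝ X] [IsOrderedModule ℝ X] [CompleteSpace X]
  [NormedAddCommGroup E] [NormedSpace ℂ E]

/-- The vectors whose orbit stays in the positive cone for all times. -/
noncomputable def posOrbitCone (T : C0Semigroup E) (L : ComplexBanachLattice X E) :
    PointedCone ℝ E :=
  ⨅ t, L.posCone.comap ((T.toFun t : E →ₗ[ℂ] E).restrictScalars ℝ)

variable {T : C0Semigroup E} {L : ComplexBanachLattice X E}

theorem mem_posOrbitCone {z : E} : z ∈ T.posOrbitCone L ↔ ∀ t, T.toFun t z ∈ L.posCone := by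
  simp [posOrbitCone, Submodule.mem_iInf]

theorem isClosed_posOrbitCone : IsClosed (T.posOrbitCone L : Set E) := by
  have : (T.posOrbitCone L : Set E) = ⋂ t, T.toFun t ⁻¹' L.posCone := by
    ext z; simp [mem_posOrbitCone]
  rw [this]
  exact isClosed_iInter fun t => L.isClosed_posCone.preimage (T.toFun t).continuous

variable [CompleteSpace E]

/-- To the right of the spectral bound, the resolvent leaves the cone of vectors with positive
orbit invariant. Far to the right it is the Laplace transform of the semigroup. -/
theorem resolvent_mapsTo_posOrbitCone {l : ℝ}
    (hA : ∀ k : ℝ, l ≤ k → (k : ℂ) ∈ UnboundedOp.resolventSet T.generator) :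
    MapsTo (UnboundedOp.resolvent T.generator l) (T.posOrbitCone L) (T.posOrbitCone L) := by
  set b := max l (Real.log ‖T.toFun 1‖ + 1)
  have hlb : l ≤ b := le_max_left _ _
  refine UnboundedOp.resolvent_mapsTo_of_le isClosed_posOrbitCone hlb hA ?_
  intro z hz
  refine mem_posOrbitCone.2 fun t => ?_
  rw [← resolvent_apply_comm (hA b hlb)]
  refine L.isClosed_posCone.mem_of_tendsto (tendsto_integral_exp_smul_orbit (hA b hlb)
    (lt_of_lt_of_le (by linarith) (le_max_right l (Real.log ‖T.toFun 1‖ + 1))) _)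
    (Eventually.of_forall fun n => ?_)
  refine PointedCone.intervalIntegral_mem L.isClosed_posCone
    ((T.continuous_exp_smul_orbit _).comp (Continuous.prodMk_right (b : ℂ))) (by simp)
    fun r _ => ?_
  have e : Complex.exp (-((b : ℂ) * r)) = ((Real.exp (-(b * r)) : ℝ) : ℂ) := by push_cast; rfl
  change Complex.exp (-((b : ℂ) * r)) • T.toFun r.toNNReal (T.toFun t z) ∈ L.posCone
  rw [e, T.apply_apply]
  exact PointedCone.coe_smul_mem (Real.exp_pos _).le (mem_posOrbitCone.1 hz _)

end C0Semigroup

/-! ### The leading Laurent coefficient of the resolvent at a pole -/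

namespace UnboundedOp

variable {E : Type*} [NormedAddCommGroup E] [NormedSpace ℂ E] {A : E →ₗ.[ℂ] E}

/-- At a pole of order `n + 1`, the rescaled resolvent `(μ - μ₀)ⁿ⁺¹ R(μ)` has a nonzero limit. -/
theorem IsResolventPole.exists_tendsto {μ₀ : ℂ} (h : IsResolventPole A μ₀) :
    ∃ (n : ℕ) (Q : E →L[ℂ] E), Q ≠ 0 ∧
      Tendsto (fun μ => (μ - μ₀) ^ (n + 1) • resolvent A μ) (𝓝[≠] μ₀) (𝓝 Q) := by
  obtain ⟨-, -, hm, ho⟩ := h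
  obtain ⟨k, hk⟩ := WithTop.ne_top_iff_exists.1 ho.ne_top
  rw [← hk] at ho
  have hk0 : k < 0 := by exact_mod_cast ho
  obtain ⟨n, rfl⟩ : ∃ n : ℕ, k = -((n + 1 : ℕ) : ℤ) := ⟨(-k).toNat - 1, by omega⟩
  obtain ⟨g, hg, hg0, he⟩ := (meromorphicOrderAt_eq_int_iff hm).1 hk.symm
  refine ⟨n, g μ₀, hg0, (hg.continuousAt.tendsto.mono_left nhdsWithin_le_nhds).congr' ?_⟩
  filter_upwards [he, self_mem_nhdsWithin] with μ hμ hne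
  have : μ - μ₀ ≠ 0 := sub_ne_zero.2 hne
  rw [hμ, smul_smul, zpow_neg, zpow_natCast, mul_inv_cancel₀ (pow_ne_zero _ this), one_smul]

theorem tendsto_sub_pow_succ (μ₀ : ℂ) (n : ℕ) :
    Tendsto (fun μ => (μ - μ₀) ^ (n + 1)) (𝓝[≠] μ₀) (𝓝 0) := by
  have : Continuous fun μ : ℂ => (μ - μ₀) ^ (n + 1) := by fun_prop
  exact (this.tendsto' μ₀ 0 (by simp)).mono_left nhdsWithin_le_nhds

variable {μ₀ : ℂ} {n : ℕ} {Q : E →L[ℂ] E}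

/-- The identity `Q = (ν - μ₀) Q R(ν)`, obtained by multiplying the resolvent identity for
`R(μ) - R(ν)` by `(μ - μ₀)ⁿ⁺¹` and letting `μ → μ₀`. -/
theorem eq_smul_leadingCoeff_mul_resolvent (hρ : ∀ᶠ μ in 𝓝[≠] μ₀, μ ∈ resolventSet A)
    (hQ : Tendsto (fun μ => (μ - μ₀) ^ (n + 1) • resolvent A μ) (𝓝[≠] μ₀) (𝓝 Q))
    {ν : ℂ} (hν : ν ∈ resolventSet A) : Q = (ν - μ₀) • (Q * resolvent A ν) := by
  have h1 := hQ.sub ((tendsto_sub_pow_succ μ₀ n).smul_const (resolvent A ν))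
  have hid : Tendsto (fun μ : ℂ => ν - μ) (𝓝[≠] μ₀) (𝓝 (ν - μ₀)) :=
    ((continuous_const.sub continuous_id).tendsto μ₀).mono_left nhdsWithin_le_nhds
  have h2 := hid.smul (hQ.mul_const (resolvent A ν))
  rw [zero_smul, sub_zero] at h1
  refine tendsto_nhds_unique (h1.congr' ?_) h2
  filter_upwards [hρ] with μ hμ
  rw [← smul_sub, resolvent_sub_resolvent hμ hν, smul_mul_assoc, smul_comm]

/-- If the pole is not simple, the leading coefficient squares to zero. -/
theorem leadingCoeff_mul_self (hρ : ∀ᶠ μ in 𝓝[≠] μ₀, μ ∈ resolventSet A)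
    (hQ : Tendsto (fun μ => (μ - μ₀) ^ (n + 1) • resolvent A μ) (𝓝[≠] μ₀) (𝓝 Q))
    (hn : n ≠ 0) : Q * Q = 0 := by
  obtain ⟨k, rfl⟩ := Nat.exists_eq_succ_of_ne_zero hn
  have h1 := (tendsto_sub_pow_succ μ₀ k).smul_const Q
  rw [zero_smul] at h1
  refine tendsto_nhds_unique (hQ.const_mul Q) (h1.congr' ?_)
  filter_upwards [hρ] with μ hμ
  conv_lhs => rw [eq_smul_leadingCoeff_mul_resolvent hρ hQ hμ]
  rw [smul_smul, ← pow_succ, mul_smul_comm]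

/-- At a simple pole, the spectral projection is the leading Laurent coefficient. -/
theorem IsSpectralProjection.eq_leadingCoeff [CompleteSpace E] {P : E →L[ℂ] E}
    (hP : IsSpectralProjection A μ₀ P)
    (hQ : Tendsto (fun μ => (μ - μ₀) • resolvent A μ) (𝓝[≠] μ₀) (𝓝 Q)) : P = Q := by
  obtain ⟨r, hr, hσ, rfl⟩ := hP
  have hmem : Metric.closedBall μ₀ r \ {μ₀} ⊆ resolventSet A := by
    rintro μ ⟨hμ, hne⟩
    by_contra hμ'
    exact hne (hσ ▸ ⟨hμ, hμ'⟩)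
  have hd : DifferentiableOn ℂ (fun μ => (μ - μ₀) • resolvent A μ)
      (Metric.closedBall μ₀ r \ {μ₀}) :=
    (by fun_prop : DifferentiableOn ℂ (fun μ => μ - μ₀) _).smul
      ((differentiableOn_resolvent A).mono hmem)
  have key := Complex.circleIntegral_sub_center_inv_smul_of_differentiable_on_off_countable_of_tendsto
    hr countable_empty hd.continuousOn (fun z hz => hd.differentiableAt ?_) hQ
  · have hI : (2 * (Real.pi : ℂ) * Complex.I) ≠ 0 := Complex.two_pi_I_ne_zero
    rw [inv_smul_eq_iff₀ hI, ← key]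
    refine circleIntegral.integral_congr hr.le fun z hz => ?_
    have hz0 : z - μ₀ ≠ 0 := sub_ne_zero.2 (by rintro rfl; simp [hr.ne] at hz)
    simp [smul_smul, inv_mul_cancel₀ hz0]
  · exact mem_of_superset ((Metric.isOpen_ball.sdiff isClosed_singleton).mem_nhds hz.1)
      (sdiff_subset_sdiff_left Metric.ball_subset_closedBall)

end UnboundedOp

namespace C0Semigroup

variable {E : Type*} [NormedAddCommGroup E] [NormedSpace ℂ E] {T : C0Semigroup E}
  {μ₀ : ℂ} {n : ℕ} {Q : E →L[ℂ] E}

theorem leadingCoeff_apply_comm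
    (hρ : ∀ᶠ μ in 𝓝[≠] μ₀, μ ∈ UnboundedOp.resolventSet T.generator)
    (hQ : Tendsto (fun μ => (μ - μ₀) ^ (n + 1) • UnboundedOp.resolvent T.generator μ)
      (𝓝[≠] μ₀) (𝓝 Q)) (t : ℝ≥0) (z : E) : Q (T.toFun t z) = T.toFun t (Q z) := by
  have h1 := ((ContinuousLinearMap.apply ℂ E (T.toFun t z)).continuous.tendsto Q).comp hQ
  have h2 := ((T.toFun t).continuous.tendsto _).comp
    (((ContinuousLinearMap.apply ℂ E z).continuous.tendsto Q).comp hQ)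
  refine tendsto_nhds_unique h1 (h2.congr' ?_)
  filter_upwards [hρ] with μ hμ
  simp [resolvent_apply_comm hμ]

/-- The range of the leading coefficient consists of eigenvectors of the semigroup. -/
theorem apply_leadingCoeff [CompleteSpace E]
    (hρ : ∀ᶠ μ in 𝓝[≠] μ₀, μ ∈ UnboundedOp.resolventSet T.generator)
    (hQ : Tendsto (fun μ => (μ - μ₀) ^ (n + 1) • UnboundedOp.resolvent T.generator μ)
      (𝓝[≠] μ₀) (𝓝 Q)) (t : ℝ≥0) (z : E) :
    Q z = Complex.exp (-(μ₀ * t)) • T.toFun t (Q z) := by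
  have h1 := ((ContinuousLinearMap.apply ℂ E z).continuous.tendsto Q).comp hQ
  have h2 := ((T.toFun t).continuous.tendsto _).comp h1
  have hexp : Continuous fun μ : ℂ => Complex.exp (-(μ * t)) := by fun_prop
  have h3 := ((hexp.tendsto μ₀).mono_left nhdsWithin_le_nhds).smul h2
  have hint := intervalIntegral.continuous_parametric_intervalIntegral_of_continuous'
    (μ := MeasureTheory.volume)
    (f := fun (μ : ℂ) (r : ℝ) => Complex.exp (-(μ * r)) • T.toFun r.toNNReal z)
    (T.continuous_exp_smul_orbit z) 0 t
  have h4 := (UnboundedOp.tendsto_sub_pow_succ μ₀ n).smul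
    ((hint.tendsto μ₀).mono_left nhdsWithin_le_nhds)
  rw [zero_smul] at h4
  refine sub_eq_zero.1 (tendsto_nhds_unique ((h1.sub h3).congr' ?_) h4)
  filter_upwards [hρ] with μ hμ
  rw [integral_exp_smul_orbit hμ, smul_sub]
  simp [smul_comm (Complex.exp _)]

end C0Semigroup

/-! ### Strong positivity of the spectral projection -/

namespace ComplexBanachLattice

variable {X E : Type*}
  [NormedAddCommGroup X] [Lattice X] [IsOrderedAddMonoid X] [HasSolidNorm X]
  [NormedSpace ℝ X] [IsOrderedModule ℝ X] [CompleteSpace X]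
  [NormedAddCommGroup E] [NormedSpace ℂ E] [CompleteSpace E]
  {L : ComplexBanachLattice X E} {T : C0Semigroup E} {u : X} {s : ℝ} {n : ℕ} {Q : E →L[ℂ] E}

/-- The leading coefficient is a positive operator: as a limit of positive multiples of `R(l)`,
`l ↓ s`, it preserves the cone of vectors with positive orbit, which every positive orbit
eventually enters. -/
theorem IndivEventuallyStronglyPos.leadingCoeff_mem_posCone (hu : 0 ≤ u)
    (hpos : L.IndivEventuallyStronglyPos u T)
    (hA : ∀ l : ℝ, s < l → (l : ℂ) ∈ UnboundedOp.resolventSet T.generator)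
    (hρ : ∀ᶠ μ in 𝓝[≠] (s : ℂ), μ ∈ UnboundedOp.resolventSet T.generator)
    (hQ : Tendsto (fun μ : ℂ => (μ - s) ^ (n + 1) • UnboundedOp.resolvent T.generator μ)
      (𝓝[≠] (s : ℂ)) (𝓝 Q)) {z : E} (hz : z ∈ L.posCone) : Q z ∈ L.posCone := by
  obtain ⟨f, hf, rfl⟩ := mem_posCone.1 hz
  rcases hf.eq_or_lt with rfl | hf
  · simp
  obtain ⟨t₀, ht₀⟩ := hpos f hf
  -- after time `t₀` the orbit of `f` is positive, and `Q` only rescales along orbits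
  have hK : T.toFun t₀ (L.ofReal f) ∈ T.posOrbitCone L := by
    refine C0Semigroup.mem_posOrbitCone.2 fun t => ?_
    rw [T.apply_apply]
    exact (ht₀ _ le_add_self).mem_posCone hu
  have hreal : Tendsto (fun l : ℝ => (l : ℂ)) (𝓝[>] s) (𝓝[≠] (s : ℂ)) := by
    refine tendsto_nhdsWithin_iff.2
      ⟨(Complex.continuous_ofReal.tendsto s).mono_left nhdsWithin_le_nhds, ?_⟩
    filter_upwards [self_mem_nhdsWithin] with l hl
    simpa using (ne_of_gt hl)
  have hlim := ((ContinuousLinearMap.apply ℂ E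
    (T.toFun t₀ (L.ofReal f))).continuous.tendsto Q).comp (hQ.comp hreal)
  have hmem : Q (T.toFun t₀ (L.ofReal f)) ∈ T.posOrbitCone L := by
    refine C0Semigroup.isClosed_posOrbitCone.mem_of_tendsto hlim ?_
    filter_upwards [self_mem_nhdsWithin] with l hl
    have hl : s < l := hl
    have h := C0Semigroup.resolvent_mapsTo_posOrbitCone (L := L)
      (fun k hk => hA k (hl.trans_le hk)) hK
    have h' := PointedCone.coe_smul_mem (pow_nonneg (sub_nonneg.2 hl.le) (n + 1)) h
    push_cast at h'
    exact h'
  rw [C0Semigroup.apply_leadingCoeff hρ hQ t₀, ← C0Semigroup.leadingCoeff_apply_comm hρ hQ]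
  have e : Complex.exp (-((s : ℂ) * t₀)) = ((Real.exp (-(s * t₀)) : ℝ) : ℂ) := by
    push_cast; rfl
  rw [e]
  refine PointedCone.coe_smul_mem (Real.exp_pos _).le ?_
  simpa [T.map_zero] using C0Semigroup.mem_posOrbitCone.1 hmem 0

/-- The leading coefficient is strongly positive: `w = Q u > 0` is an eigenvector of the
semigroup, hence `w ≫_u 0`; and `T(t) f ≥ ε u` gives `Q T(t) f ≥ ε w`, where `Q T(t) f` is a
positive multiple of `Q f`. -/
theorem IndivEventuallyStronglyPos.opStronglyPos_leadingCoeff (hu : L.IsQuasiInterior u)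
    (hpos : L.IndivEventuallyStronglyPos u T)
    (hA : ∀ l : ℝ, s < l → (l : ℂ) ∈ UnboundedOp.resolventSet T.generator)
    (hρ : ∀ᶠ μ in 𝓝[≠] (s : ℂ), μ ∈ UnboundedOp.resolventSet T.generator)
    (hQ : Tendsto (fun μ : ℂ => (μ - s) ^ (n + 1) • UnboundedOp.resolvent T.generator μ)
      (𝓝[≠] (s : ℂ)) (𝓝 Q)) (hQ0 : Q ≠ 0) : L.OpStronglyPos u Q := by
  have hQpos : ∀ z ∈ L.posCone, Q z ∈ L.posCone := fun z hz =>
    hpos.leadingCoeff_mem_posCone hu.1 hA hρ hQ hz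
  have hexp (t : ℝ≥0) (z : E) : Q z = Real.exp (-(s * t)) • T.toFun t (Q z) := by
    rw [← Complex.coe_smul]
    push_cast
    exact C0Semigroup.apply_leadingCoeff hρ hQ t z
  obtain ⟨w, hw, hwQ⟩ := mem_posCone.1 (hQpos _ (ofReal_mem_posCone.2 hu.1))
  have hw0 : w ≠ 0 := by
    rintro rfl
    exact hQ0 (hu.eq_zero_of_apply_eq_zero hQpos (by rw [← hwQ, map_zero]))
  have hQu : L.VecStronglyPos u (Q (L.ofReal u)) := by
    obtain ⟨t₀, ht₀⟩ := hpos w (hw.lt_of_ne' hw0)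
    rw [hexp t₀, ← hwQ]
    exact (ht₀ t₀ le_rfl).smul (Real.exp_pos _)
  intro f hf
  obtain ⟨t₀, ht₀⟩ := hpos f hf
  obtain ⟨ε, hε, h⟩ := vecStronglyPos_iff.1 (ht₀ t₀ le_rfl)
  rw [hexp t₀, ← C0Semigroup.leadingCoeff_apply_comm hρ hQ]
  refine VecStronglyPos.smul ?_ (Real.exp_pos _)
  have := (hQu.smul hε).add_mem_posCone (hQpos _ h)
  rwa [map_sub, ContinuousLinearMap.map_smul_of_tower, sub_add_cancel] at this

end ComplexBanachLattice

theorem UnboundedOp.mem_resolventSet_of_spectralBound_lt {E : Type*} [NormedAddCommGroup E]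
    [NormedSpace ℂ E] {A : E →ₗ.[ℂ] E} {μ : ℂ} (h : spectralBound A < (μ.re : EReal)) :
    μ ∈ resolventSet A := by
  by_contra hμ
  exact h.not_ge (le_sSup ⟨μ, hμ, rfl⟩)

theorem mainTheorem2 {X E : Type*}
    [NormedAddCommGroup X] [Lattice X] [IsOrderedAddMonoid X] [HasSolidNorm X]
    [NormedSpace ℝ X] [IsOrderedModule ℝ X] [CompleteSpace X]
    [NormedAddCommGroup E] [NormedSpace ℂ E] [CompleteSpace E]
    (L : ComplexBanachLattice X E)
    (T : C0Semigroup E) (hreal : ∀ t, L.IsRealOp (T.toFun t))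
    (u : X) (hu : L.IsQuasiInterior u)
    (s : ℝ) (hs : UnboundedOp.spectralBound T.generator = (s : EReal))
    (hpole : UnboundedOp.IsResolventPole T.generator (s : ℂ))
    (hpos : L.IndivEventuallyStronglyPos u T)
    (P : E →L[ℂ] E) (hP : UnboundedOp.IsSpectralProjection T.generator (s : ℂ) P) :
    L.OpStronglyPos u P := by
  have hA : ∀ l : ℝ, s < l → (l : ℂ) ∈ UnboundedOp.resolventSet T.generator := fun l hl =>
    UnboundedOp.mem_resolventSet_of_spectralBound_lt (by simpa [hs] using hl)
  have hρ := hpole.2.1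
  obtain ⟨n, Q, hQ0, hQ⟩ := hpole.exists_tendsto
  have hstrong := hpos.opStronglyPos_leadingCoeff hu hA hρ hQ hQ0
  have hu0 : 0 < u := by
    refine hu.1.lt_of_ne' ?_
    rintro rfl
    refine hQ0 (hu.eq_zero_of_apply_eq_zero (fun z hz => ?_) (by simp))
    exact hpos.leadingCoeff_mem_posCone le_rfl hA hρ hQ hz
  -- `Q` maps positive vectors to nonzero positive ones, so `Q² ≠ 0` and the pole is simple
  have hne : ∀ f : X, 0 < f → ∃ g : X, Q (L.ofReal f) = L.ofReal g ∧ 0 < g := by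
    intro f hf
    obtain ⟨g, hg, ε, hε, hle⟩ := hstrong f hf
    exact ⟨g, hg, ((smul_nonneg hε.le hu.1).lt_of_ne' (smul_ne_zero hε.ne' hu0.ne')).trans_le hle⟩
  obtain rfl : n = 0 := by
    by_contra hn
    obtain ⟨v, hv, hv0⟩ := hne u hu0
    obtain ⟨w, hw, hw0⟩ := hne v hv0
    have h : (Q * Q) (L.ofReal u) = L.ofReal w := by rw [← hw, ← hv]; rfl
    rw [UnboundedOp.leadingCoeff_mul_self hρ hQ hn, zero_apply, ← map_zero L.ofReal] at h
    exact hw0.ne (L.isometry_ofReal.injective h)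
  rw [hP.eq_leadingCoeff (by simpa using hQ)]
  exact hstrong
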